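/- Let $d\ge 1$ and let $\nu$ be a symmetric Lévy measure on $\mathbb{R}^d\setminus\{0\}$, i.e. a Borel measure with $\nu(-B)=\nu(B)$ for all Borel sets $B$ and $\int (1\wedge|y|^2)\,\nu(dy)<\infty$. Let $\{\mu_t: t\ge 0\}$ be a convolution semigroup of probability measures on $\mathbb{R}^d$ (that is, $\mu_{s+t}=\mu_s*\mu_t$ for $s,t>0$, $\mu_0=\delta_0$, and $\lim_{t\downarrow 0}\int\phi\,d\mu_t=\phi(0)$ for all $\phi\in C_c(\mathbb{R}^d)$) such that $$\int_{\mathbb{R}^d} e^{i\langle \xi,y\rangle}\,\mu_t(dy)=e^{-t\Psi(\xi)},\qquad \Psi(\xi)=\int_{\mathbb{R}^d\setminus\{0\}}\bigl(1-\cos\langle\xi,y\rangle\bigr)\,\nu(dy),\qquad \xi\in\mathbb{R}^d,\ t\ge 0,$$ and assume that $\int_{\mathbb{R}^d} e^{-t\Psi(z)}\,dz<\infty$ for all $t>0$. Let $\xi_0\in\mathbb{R}^d$ be such that $$\int_{|y|\ge 1} e^{\langle \xi_0,y\rangle}\,\nu(dy)<\infty .$$ Then $\omega(\xi_0):=\int_{\mathbb{R}^d\setminus\{0\}}\bigl(\cosh\langle\xi_0,y\rangle-1\bigr)\,\nu(dy)$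 is finite, for every $t>0$ the measure $\mu_t$ has a (unique) continuous density $p_t$ with respect to Lebesgue measure, and $$p_t(x)\le p_t(0)\,e^{-\langle\xi_0,x\rangle+t\,\omega(\xi_0)},\qquad x\in\mathbb{R}^d,\ t>0 .$$ -/

import Mathlib

open MeasureTheory Filter Topology
open scoped NNReal ENNReal

noncomputable section

/-- A convolution semigroup of probability measures `{μ_t : t ≥ 0}` on `ℝᵈ`:
`μ_{s+t} = μ_s * μ_t`, `μ_0 = δ_0`, and `∫ φ dμ_t → φ(0)` as `t ↓ 0` for all `φ ∈ C_c(ℝᵈ)`. -/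
structure IsConvolutionSemigroup {d : ℕ}
    (μ : ℝ≥0 → Measure (EuclideanSpace ℝ (Fin d))) : Prop where
  isProbabilityMeasure : ∀ t, IsProbabilityMeasure (μ t)
  conv_eq : ∀ s t, 0 < s → 0 < t → μ (s + t) = (μ s).conv (μ t)
  zero_eq : μ 0 = Measure.dirac 0
  tendsto_zero : ∀ φ : EuclideanSpace ℝ (Fin d) → ℝ, Continuous φ → HasCompactSupport φ →
    Tendsto (fun t => ∫ y, φ y ∂(μ t)) (𝓝[>] 0) (𝓝 (φ 0))

/-- A Lévy measure on `ℝᵈ ∖ {0}`, regarded as a measure on `ℝᵈ` which does not charge the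
origin: `∫ (1 ∧ |y|²) ν(dy) < ∞`. -/
structure IsLevyMeasure {d : ℕ} (ν : Measure (EuclideanSpace ℝ (Fin d))) : Prop where
  singleton_zero : ν {0} = 0
  lintegral_lt_top : ∫⁻ y, ENNReal.ofReal (min 1 (‖y‖ ^ 2)) ∂ν < ∞

/-- The real characteristic exponent `Ψ(ξ) = ∫ (1 - cos⟨ξ, y⟩) ν(dy)`. -/
def levyExponent {d : ℕ} (ν : Measure (EuclideanSpace ℝ (Fin d)))
    (ξ : EuclideanSpace ℝ (Fin d)) : ℝ :=
  ∫ y, (1 - Real.cos (inner ℝ ξ y)) ∂ν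

/-- `ω(ξ) = ∫ (cosh⟨ξ, y⟩ - 1) ν(dy)`. -/
def levyOmega {d : ℕ} (ν : Measure (EuclideanSpace ℝ (Fin d)))
    (ξ : EuclideanSpace ℝ (Fin d)) : ℝ :=
  ∫ y, (Real.cosh (inner ℝ ξ y) - 1) ∂ν

/-- `p` is the continuous density of `m` with respect to Lebesgue measure. -/
structure IsContinuousDensity {d : ℕ} (m : Measure (EuclideanSpace ℝ (Fin d)))
    (p : EuclideanSpace ℝ (Fin d) → ℝ) : Prop where
  continuous : Continuous p
  nonneg : ∀ x, 0 ≤ p x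
  eq_withDensity : m = volume.withDensity (fun x => ENNReal.ofReal (p x))

end

open scoped FourierTransform ContDiff SchwartzMap RealInnerProductSpace

/-! By Fourier inversion, `p_t(x)` is `(2π)⁻ᵈ` times the integral of `e^{-i⟨z,x⟩ - tΨ(z)}` over `z`.
Exponential integrability lets `Ψ` extend to complex frequencies, and the contour is shifted from
`z` to `z - isξ₀` with `0 < s < 1`. The shift produces the factor `e^{-s⟨ξ₀,x⟩}`, and `Re Ψ(z -
isξ₀) ≥ Ψ(z) - ω(ξ₀)` (`le_re_levyExponentC`) bounds the rest by `e^{tω(ξ₀)} ∫ e^{-tΨ}`, which is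
`(2π)ᵈ p_t(0) e^{tω(ξ₀)}`. Letting `s → 1` gives the claim.

The shift itself (`integral_inversionIntegrand_eq`) uses no contour in `ℂᵈ`: one complex parameter
`w` moves the frequency along `wξ₀`, and translation invariance of Lebesgue measure makes the
holomorphic function of `w` constant. Existence of the density is Fourier inversion for a finite
measure with integrable characteristic function (`eq_withDensity_charFunInv`). -/

/-! ### Holomorphic dependence of integrals on a parameter. -/

/-- Cauchy's estimate on circles of radius `R / 4` turns the local bound `g` on `F` into the bound
`g / (R / 4)` on its derivative, so no domination of the derivative has to be assumed. -/
theorem differentiableOn_integral_of_locally_dominated {α : Type*} [MeasurableSpace α]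
    {μ : Measure α} {F : ℂ → α → ℂ} {U : Set ℂ} (hU : IsOpen U)
    (hmeas : ∀ w ∈ U, AEStronglyMeasurable (F w) μ)
    (hdiff : ∀ a, DifferentiableOn ℂ (fun w => F w a) U)
    (hbound : ∀ w ∈ U, ∃ g : α → ℝ, Integrable g μ ∧ ∀ᶠ v in 𝓝 w, ∀ a, ‖F v a‖ ≤ g a) :
    DifferentiableOn ℂ (fun w => ∫ a, F w a ∂μ) U := by
  intro w hw
  obtain ⟨g, hg, hgb⟩ := hbound w hw
  obtain ⟨R, hR, hball⟩ := Metric.mem_nhds_iff.1 (inter_mem (hU.mem_nhds hw) hgb)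
  have hr : 0 < R / 2 := half_pos hR
  have hderiv : ∀ a, ∀ v ∈ Metric.ball w (R / 2), HasDerivAt (fun w => F w a)
      (deriv (fun w => F w a) v) v := fun a v hv =>
    ((hdiff a).differentiableAt (hU.mem_nhds
      (hball (Metric.ball_subset_ball (by linarith) hv)).1)).hasDerivAt
  have hmemU : ∀ v ∈ Metric.ball w (R / 2), v ∈ U := fun v hv =>
    (hball (Metric.ball_subset_ball (by linarith) hv)).1
  have hsub : ∀ v ∈ Metric.ball w (R / 2), Metric.closedBall v (R / 4) ⊆ Metric.ball w R := by
    intro v hv u hu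
    rw [Metric.mem_ball] at *
    rw [Metric.mem_closedBall] at hu
    linarith [dist_triangle u v w]
  have hseq : Tendsto (fun n : ℕ => w + ((R / 4 / (n + 1) : ℝ) : ℂ)) atTop (𝓝[≠] w) := by
    refine tendsto_nhdsWithin_iff.2 ⟨?_, Eventually.of_forall fun n => ?_⟩
    · have h : Tendsto (fun n : ℕ => R / 4 / ((n : ℝ) + 1)) atTop (𝓝 0) :=
        tendsto_const_nhds.div_atTop
          (tendsto_atTop_add_const_right _ _ tendsto_natCast_atTop_atTop)
      simpa using tendsto_const_nhds.add ((Complex.continuous_ofReal.tendsto 0).comp h)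
    · have : R / 4 / ((n : ℝ) + 1) ≠ 0 := by positivity
      simpa only [Set.mem_compl_iff, Set.mem_singleton_iff, add_eq_left, Complex.ofReal_eq_zero]
  have key := hasDerivAt_integral_of_dominated_loc_of_deriv_le (μ := μ) (F := F)
    (F' := fun v a => deriv (fun w => F w a) v) (x₀ := w) (bound := fun a => g a / (R / 4))
    (Metric.ball_mem_nhds w hr)
    (Eventually.mono (Metric.ball_mem_nhds w hr) fun v hv => hmeas v (hmemU v hv))
    (hg.mono' (hmeas w hw) (ae_of_all _ hgb.self_of_nhds)) ?_
    (ae_of_all _ fun a v hv => ?_) (hg.div_const _) (ae_of_all _ hderiv)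
  · exact key.2.differentiableAt.differentiableWithinAt
  -- The derivative is measurable in `a` as a limit of difference quotients; starting at index `N`
  -- keeps the sample points in `U`, where `F` is measurable.
  · have hev : ∀ᶠ n : ℕ in atTop, w + ((R / 4 / (n + 1) : ℝ) : ℂ) ∈ U :=
      (hseq.mono_right nhdsWithin_le_nhds).eventually (hU.mem_nhds hw)
    obtain ⟨N, hN⟩ := eventually_atTop.1 hev
    refine aestronglyMeasurable_of_tendsto_ae atTop
      (f := fun n a => slope (fun w => F w a) w (w + ((R / 4 / ((n + N : ℕ) + 1) : ℝ) : ℂ)))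
      (fun n => ?_) (ae_of_all _ fun a => ?_)
    · simp only [slope, vsub_eq_sub]
      exact ((hmeas _ (hN (n + N) (Nat.le_add_left N n))).sub (hmeas _ hw)).const_smul
        (w + ((R / 4 / ((n + N : ℕ) + 1) : ℝ) : ℂ) - w)⁻¹
    · exact ((hderiv a w (Metric.mem_ball_self hr)).tendsto_slope).comp
        (hseq.comp (tendsto_add_atTop_nat N))
  · refine Complex.norm_deriv_le_of_forall_mem_sphere_norm_le (by positivity) ?_ ?_
    · refine DifferentiableOn.diffContOnCl ?_
      refine (hdiff a).mono fun u hu => (hball (hsub v hv ?_)).1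
      exact (Metric.closure_ball_subset_closedBall) hu
    · exact fun u hu => (hball (hsub v hv (Metric.sphere_subset_closedBall hu))).2 a

/-! ### Fourier inversion for finite measures with integrable characteristic function. -/

section Density

variable {E : Type*} [NormedAddCommGroup E] [InnerProductSpace ℝ E] [FiniteDimensional ℝ E]
  [MeasurableSpace E] [BorelSpace E]

/-- The function `x ↦ (2π)⁻ᵈ ∫ e^{-i⟨z, x⟩} charFun μ z dz`, written as an inverse Fourier
transform in Mathlib's normalisation. -/
noncomputable def charFunInv (μ : Measure E) : E → ℂ :=
  𝓕⁻ (fun z : E => charFun μ (-(2 * Real.pi) • z))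

theorem charFunInv_apply (μ : Measure E) (x : E) :
    charFunInv μ x = (((2 * Real.pi) ^ Module.finrank ℝ E)⁻¹ : ℝ) •
      ∫ z, Complex.exp (-(⟪z, x⟫ : ℂ) * Complex.I) * charFun μ z := by
  have h := Measure.integral_comp_smul (volume : Measure E)
    (fun z => Complex.exp (-(⟪z, x⟫ : ℂ) * Complex.I) * charFun μ z) (-(2 * Real.pi))
  rw [charFunInv, Real.fourierInv_eq']
  have habs : |((-(2 * Real.pi)) ^ Module.finrank ℝ E)⁻¹|
      = ((2 * Real.pi) ^ Module.finrank ℝ E)⁻¹ := by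
    rw [abs_inv, abs_pow, abs_neg, abs_of_pos Real.two_pi_pos]
  rw [habs] at h
  rw [← h]
  refine integral_congr_ae (ae_of_all _ fun z => ?_)
  simp only [inner_smul_left, smul_eq_mul]
  congr 2
  push_cast
  simp

theorem integrable_charFun_smul {μ : Measure E} (hf : Integrable (charFun μ)) :
    Integrable (fun z : E => charFun μ (-(2 * Real.pi) • z)) :=
  hf.comp_smul (neg_ne_zero.2 Real.two_pi_pos.ne')

theorem continuous_charFunInv {μ : Measure E} (hf : Integrable (charFun μ)) : Continuous (charFunInv μ) := by
  have h := VectorFourier.fourierIntegral_continuous (V := E) (W := E) (μ := volume)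
    (L := -innerₗ E) Real.continuous_fourierChar (by exact (continuous_inner (𝕜 := ℝ) (E := E)).neg) (integrable_charFun_smul hf)
  exact h

theorem charFunInv_im (μ : Measure E) (x : E) : (charFunInv μ x).im = 0 := by
  rw [← Complex.conj_eq_iff_im, charFunInv, Real.fourierInv_eq', ← integral_conj,
    ← integral_neg_eq_self]
  refine integral_congr_ae (ae_of_all _ fun z => ?_)
  simp only [smul_eq_mul, map_mul, ← Complex.exp_conj, smul_neg, charFun_neg, inner_neg_left,
    Complex.conj_conj, Complex.conj_ofReal, Complex.conj_I]
  congr 2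
  push_cast
  ring

variable {μ : Measure E} [IsFiniteMeasure μ]

/-- Write `g = 𝓕 h` and move the Fourier transform across the pairing twice by Fubini: from `h` onto
`μ`, then from `g` onto `charFun μ`. -/
theorem integral_schwartz_eq_integral_charFunInv (hf : Integrable (charFun μ)) (g : 𝓢(E, ℂ)) :
    ∫ x, g x ∂μ = ∫ x, charFunInv μ x * g x := by
  set h : 𝓢(E, ℂ) := 𝓕⁻ g with hh
  have hgh : ∀ x, g x = 𝓕 (h : E → ℂ) x := fun x => by
    rw [← SchwartzMap.fourier_coe, hh, FourierTransform.fourier_fourierInv_eq]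
  have hhg : ∀ x, h x = 𝓕⁻ (g : E → ℂ) x := fun x => by
    rw [← SchwartzMap.fourierInv_coe]
  have h1 := VectorFourier.integral_fourierIntegral_smul_eq_flip (V := E) (W := E)
    (μ := μ) (ν := volume) (L := innerₗ E) (f := fun _ => (1 : ℂ)) (g := h)
    Real.continuous_fourierChar (by exact continuous_inner) (integrable_const _) h.integrable
  have h2 := VectorFourier.integral_fourierIntegral_smul_eq_flip (V := E) (W := E)
    (μ := volume) (ν := volume) (L := -innerₗ E)
    (f := fun z : E => charFun μ (-(2 * Real.pi) • z)) (g := g)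
    Real.continuous_fourierChar (by exact (continuous_inner (𝕜 := ℝ) (E := E)).neg)
    (integrable_charFun_smul hf) g.integrable
  have e1 : ∀ z, VectorFourier.fourierIntegral Real.fourierChar μ (innerₗ E)
      (fun _ => (1 : ℂ)) z = charFun μ (-(2 * Real.pi) • z) := fun z => by
    rw [charFun_eq_fourierIntegral', smul_smul]
    have : -(2 * Real.pi)⁻¹ * -(2 * Real.pi) = 1 := by
      field_simp
    rw [this, one_smul]; rfl
  have fl : (innerₗ E).flip = innerₗ E := by
    ext x y; exact real_inner_comm _ _
  have fl' : (-innerₗ E).flip = -innerₗ E := by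
    ext x y; simp [real_inner_comm]
  rw [fl] at h1
  rw [fl'] at h2
  simp only [one_smul, e1] at h1
  calc ∫ x, g x ∂μ = ∫ x, 𝓕 (h : E → ℂ) x ∂μ := by simp only [hgh]
    _ = ∫ z, charFun μ (-(2 * Real.pi) • z) • h z := h1.symm
    _ = ∫ z, charFun μ (-(2 * Real.pi) • z) • 𝓕⁻ (g : E → ℂ) z := by simp only [hhg]
    _ = _ := h2.symm

theorem integral_bump_eq_integral_charFunInv (hf : Integrable (charFun μ)) {g : E → ℝ}
    (hg : ContDiff ℝ ∞ g) (hc : HasCompactSupport g) :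
    ∫ x, g x ∂μ = ∫ x, g x * (charFunInv μ x).re := by
  have hc' : HasCompactSupport (fun x => (g x : ℂ)) := hc.comp_left (g := ((↑) : ℝ → ℂ)) (by simp)
  have hg' : ContDiff ℝ ∞ (fun x => (g x : ℂ)) := Complex.ofRealCLM.contDiff.comp hg
  have h := integral_schwartz_eq_integral_charFunInv hf (hc'.toSchwartzMap hg')
  have hre : ∀ x, charFunInv μ x = ((charFunInv μ x).re : ℂ) := fun x => by
    apply Complex.ext <;> simp [charFunInv_im]
  have h3 : ∀ x, charFunInv μ x * (hc'.toSchwartzMap hg') x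
      = ((g x * (charFunInv μ x).re : ℝ) : ℂ) := fun x => by
    rw [hre x]; simp [mul_comm]
  simp only [h3] at h
  have h4 : ∀ x, (hc'.toSchwartzMap hg') x = ((g x : ℝ) : ℂ) := fun x => rfl
  simp only [h4] at h
  exact_mod_cast h

/-- A negative value persists on a ball by continuity; a bump supported there would have a negative
integral against `μ`. -/
theorem charFunInv_re_nonneg (hf : Integrable (charFun μ)) (x : E) :
    0 ≤ (charFunInv μ x).re := by
  by_contra! hx
  have hcont : Continuous fun x => (charFunInv μ x).re :=
    Complex.continuous_re.comp (continuous_charFunInv hf)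
  obtain ⟨r, hr, hball⟩ := Metric.mem_nhds_iff.1
    ((isOpen_Iio.preimage hcont).mem_nhds hx)
  let φ : ContDiffBump x := ⟨r / 2, r, half_pos hr, half_lt_self hr⟩
  have h := integral_bump_eq_integral_charFunInv hf φ.contDiff φ.hasCompactSupport
  have h0 : 0 ≤ ∫ y, φ y ∂μ := integral_nonneg fun y => φ.nonneg
  have hle : ∀ y, 0 ≤ -(φ y * (charFunInv μ y).re) := fun y => by
    by_cases hy : y ∈ Metric.ball x r
    · have : (charFunInv μ y).re < 0 := hball hy
      nlinarith [φ.nonneg (x := y)]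
    · have : φ y = 0 := φ.zero_of_le_dist (by simpa using hy)
      simp [this]
  have hpos : 0 < ∫ y, -(φ y * (charFunInv μ y).re) := by
    refine Continuous.integral_pos_of_hasCompactSupport_nonneg_nonzero (x := x)
      (φ.continuous.mul hcont).neg ?_ hle ?_
    · exact (φ.hasCompactSupport.mul_right).neg
    · have : φ x = 1 := φ.one_of_mem_closedBall (Metric.mem_closedBall_self φ.rIn_pos.le)
      simp [this, hx.ne]
  rw [integral_neg] at hpos
  linarith

/-- By nonnegativity it suffices to bound integrals over balls; a bump equal to 1 on the ball bounds
them by the total mass of `μ`. -/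
theorem integrable_charFunInv (hf : Integrable (charFun μ)) :
    Integrable (charFunInv μ) := by
  have hcont : Continuous fun x => (charFunInv μ x).re :=
    Complex.continuous_re.comp (continuous_charFunInv hf)
  have hint : Integrable (fun x => (charFunInv μ x).re) := by
    refine (aecover_closedBall (x := (0 : E)) (r := fun n : ℕ => (n : ℝ) + 1) ?_
      : AECover volume atTop _).integrable_of_integral_bounded_of_nonneg_ae (μ.real Set.univ)
      (fun n => hcont.continuousOn.integrableOn_compact (isCompact_closedBall _ _))
      (ae_of_all _ (charFunInv_re_nonneg hf)) (Eventually.of_forall fun n => ?_)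
    · exact tendsto_atTop_add_const_right _ _ tendsto_natCast_atTop_atTop
    · let φ : ContDiffBump (0 : E) := ⟨n + 1, n + 2, by positivity, by linarith⟩
      have h := integral_bump_eq_integral_charFunInv hf φ.contDiff φ.hasCompactSupport
      calc ∫ x in Metric.closedBall 0 ((n : ℝ) + 1), (charFunInv μ x).re
          = ∫ x in Metric.closedBall 0 ((n : ℝ) + 1), φ x * (charFunInv μ x).re := by
            refine setIntegral_congr_fun measurableSet_closedBall fun x hx => ?_
            simp [φ.one_of_mem_closedBall hx]
        _ ≤ ∫ x, φ x * (charFunInv μ x).re := by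
            refine setIntegral_le_integral ?_
              (ae_of_all _ fun x => mul_nonneg φ.nonneg (charFunInv_re_nonneg hf x))
            exact (φ.continuous.mul hcont).integrable_of_hasCompactSupport
              φ.hasCompactSupport.mul_right
        _ = ∫ x, φ x ∂μ := h.symm
        _ ≤ ∫ x, (1 : ℝ) ∂μ := by
            refine integral_mono_of_nonneg (ae_of_all _ fun x => φ.nonneg) (integrable_const _)
              (ae_of_all _ fun x => φ.le_one)
        _ = μ.real Set.univ := by simp
  refine hint.ofReal.congr (ae_of_all _ fun x => ?_)
  apply Complex.ext <;> simp [charFunInv_im]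

theorem eq_withDensity_charFunInv (hf : Integrable (charFun μ)) :
    μ = volume.withDensity (fun x => ENNReal.ofReal (charFunInv μ x).re) := by
  have hint := integrable_charFunInv hf
  have hfin : IsFiniteMeasure
      (volume.withDensity (fun x => ENNReal.ofReal (charFunInv μ x).re)) :=
    isFiniteMeasure_withDensity_ofReal hint.re.2
  refine Measure.ext_of_charFun (funext fun t => ?_)
  -- The evaluation point undoes the `-2π` rescaling, so inversion returns `charFun μ t`.
  have hinv := (integrable_charFun_smul hf).fourier_fourierInv_eq (v := -(2 * Real.pi)⁻¹ • t)
    (by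
      refine hint.comp_neg.congr (ae_of_all _ fun x => ?_)
      simp only [charFunInv]
      rw [Real.fourierInv_eq_fourier_neg, neg_neg])
    (by exact (continuous_charFun.comp (continuous_const_smul _)).continuousAt)
  have e1 : -(2 * Real.pi) • (-(2 * Real.pi)⁻¹ • t) = t := by
    rw [smul_smul]
    have : -(2 * Real.pi) * -(2 * Real.pi)⁻¹ = 1 := by field_simp
    rw [this, one_smul]
  rw [e1] at hinv
  rw [← hinv, charFun_apply, integral_withDensity_eq_integral_toReal_smul₀
    (by exact (hint.re.aestronglyMeasurable.aemeasurable).ennreal_ofReal)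
    (ae_of_all _ fun x => ENNReal.ofReal_lt_top), Real.fourier_eq']
  refine integral_congr_ae (ae_of_all _ fun x => ?_)
  have hre : ((charFunInv μ x).re : ℂ) = charFunInv μ x := by
    apply Complex.ext <;> simp [charFunInv_im]
  change Complex.exp _ • charFunInv μ x = _
  simp only [ENNReal.toReal_ofReal (charFunInv_re_nonneg hf x), Complex.real_smul, hre]
  rw [smul_eq_mul, mul_comm]
  congr 3
  rw [inner_smul_right]
  congr 1
  field_simp

end Density

/-! ### Inequalities for `cos` and `cosh`. -/

theorem Complex.norm_one_sub_cos (z : ℂ) :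
    ‖1 - Complex.cos z‖ = Real.cosh z.im - Real.cos z.re := by
  have hre : (Complex.cos z).re = Real.cos z.re * Real.cosh z.im := by
    rw [Complex.cos_eq]; simp [← Complex.ofReal_cos, ← Complex.ofReal_cosh, ← Complex.ofReal_sin,
      ← Complex.ofReal_sinh]
  have him : (Complex.cos z).im = -(Real.sin z.re * Real.sinh z.im) := by
    rw [Complex.cos_eq]; simp [← Complex.ofReal_cos, ← Complex.ofReal_cosh, ← Complex.ofReal_sin,
      ← Complex.ofReal_sinh]
  have h0 : 0 ≤ Real.cosh z.im - Real.cos z.re := by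
    linarith [Real.one_le_cosh z.im, Real.cos_le_one z.re]
  rw [← sq_eq_sq₀ (norm_nonneg _) h0, Complex.sq_norm, Complex.normSq_apply]
  simp only [Complex.sub_re, Complex.sub_im, Complex.one_re, Complex.one_im, hre, him]
  have h1 := Real.sin_sq_add_cos_sq z.re
  have h2 := Real.cosh_sq z.im
  have h3 : Real.sin z.re ^ 2 = 1 - Real.cos z.re ^ 2 := by linarith
  have h4 : Real.sinh z.im ^ 2 = Real.cosh z.im ^ 2 - 1 := by linarith
  linear_combination (Real.sinh z.im ^ 2) * h3 + (1 - Real.cos z.re ^ 2) * h4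

/-- With `z = a + ib`, the difference of the two sides is `(1 - cos a)(cosh b - 1) ≥ 0`. This is the
source of `ω` in the final bound. -/
theorem Complex.re_one_sub_cos_ge (z : ℂ) :
    (1 - Real.cos z.re) - (Real.cosh z.im - 1) ≤ (1 - Complex.cos z).re := by
  have hre : (Complex.cos z).re = Real.cos z.re * Real.cosh z.im := by
    rw [Complex.cos_eq]; simp [← Complex.ofReal_cos, ← Complex.ofReal_cosh, ← Complex.ofReal_sin,
      ← Complex.ofReal_sinh]
  rw [Complex.sub_re, Complex.one_re, hre]
  nlinarith [Real.one_le_cosh z.im, Real.cos_le_one z.re]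

/-- Since `1 - cos x = 2 sin²(x/2)`, this is `(u - v)² ≤ 2u² + 2v²`. It compares `Ψ` at `z` and at a
translate of `z`. -/
theorem Real.one_sub_cos_le_two_mul_add (a b : ℝ) :
    1 - Real.cos a ≤ 2 * (1 - Real.cos (a + b)) + 2 * (1 - Real.cos b) := by
  have h : ∀ x : ℝ, 1 - Real.cos x = 2 * Real.sin (x / 2) ^ 2 := fun x => by
    have h1 := Real.cos_two_mul (x / 2)
    rw [mul_div_cancel₀ _ (two_ne_zero' ℝ)] at h1
    linarith [Real.sin_sq_add_cos_sq (x / 2)]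
  rw [h, h, h]
  have e : Real.sin (a / 2) = Real.sin ((a + b) / 2) * Real.cos (b / 2)
      - Real.cos ((a + b) / 2) * Real.sin (b / 2) := by
    rw [← Real.sin_sub]; congr 1; ring
  have p1 : (Real.sin ((a + b) / 2) * Real.cos (b / 2)) ^ 2 ≤ Real.sin ((a + b) / 2) ^ 2 := by
    rw [mul_pow]
    exact mul_le_of_le_one_right (sq_nonneg _) (Real.cos_sq_le_one _)
  have p2 : (Real.cos ((a + b) / 2) * Real.sin (b / 2)) ^ 2 ≤ Real.sin (b / 2) ^ 2 := by
    rw [mul_pow]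
    exact mul_le_of_le_one_left (sq_nonneg _) (Real.cos_sq_le_one _)
  rw [e]
  nlinarith [sq_nonneg (Real.sin ((a + b) / 2) * Real.cos (b / 2)
    + Real.cos ((a + b) / 2) * Real.sin (b / 2))]

theorem Real.cosh_sub_one_le (x : ℝ) :
    Real.cosh x - 1 ≤ x ^ 2 / 2 * Real.exp (x ^ 2 / 2) := by
  have h1 := Real.cosh_le_exp_half_sq x
  have h2 := Real.add_one_le_exp (-(x ^ 2 / 2))
  have h3 : Real.exp (x ^ 2 / 2) * Real.exp (-(x ^ 2 / 2)) = 1 := by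
    rw [← Real.exp_add]; simp
  nlinarith [Real.exp_pos (x ^ 2 / 2)]

/-! ### Integrability against a Lévy measure and growth of `Ψ`. -/

variable {d : ℕ} {ν : Measure (EuclideanSpace ℝ (Fin d))}

theorem one_sub_cos_inner_le (ξ y : EuclideanSpace ℝ (Fin d)) :
    1 - Real.cos ⟪ξ, y⟫ ≤ (2 + ‖ξ‖ ^ 2) * min 1 (‖y‖ ^ 2) := by
  have h1 := Real.one_sub_sq_div_two_le_cos (x := ⟪ξ, y⟫)
  have h2 : ⟪ξ, y⟫ ^ 2 ≤ ‖ξ‖ ^ 2 * ‖y‖ ^ 2 := by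
    rw [← mul_pow, ← sq_abs]
    exact pow_le_pow_left₀ (abs_nonneg _) (abs_real_inner_le_norm ξ y) 2
  rcases min_cases 1 (‖y‖ ^ 2) with ⟨h, -⟩ | ⟨h, -⟩ <;> rw [h]
  · nlinarith [Real.neg_one_le_cos ⟪ξ, y⟫, sq_nonneg ‖ξ‖]
  · nlinarith [sq_nonneg ‖y‖, mul_nonneg (sq_nonneg ‖ξ‖) (sq_nonneg ‖y‖)]

namespace IsLevyMeasure

theorem integrable_min (hν : IsLevyMeasure ν) :
    Integrable (fun y => min 1 (‖y‖ ^ 2)) ν := by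
  refine ⟨Continuous.aestronglyMeasurable (by fun_prop), ?_⟩
  rw [hasFiniteIntegral_iff_ofReal (ae_of_all _ fun y => by positivity)]
  exact hν.lintegral_lt_top

theorem integrable_one_sub_cos (hν : IsLevyMeasure ν) (ξ : EuclideanSpace ℝ (Fin d)) :
    Integrable (fun y => 1 - Real.cos ⟪ξ, y⟫) ν := by
  refine (hν.integrable_min.const_mul (2 + ‖ξ‖ ^ 2)).mono'
    (Continuous.aestronglyMeasurable (by fun_prop)) (ae_of_all _ fun y => ?_)
  rw [Real.norm_of_nonneg (by linarith [Real.cos_le_one ⟪ξ, y⟫])]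
  exact one_sub_cos_inner_le ξ y

theorem integrable_cosh_sub_one (hν : IsLevyMeasure ν) (hsymm : ν.IsNegInvariant)
    {ξ : EuclideanSpace ℝ (Fin d)}
    (hξ : IntegrableOn (fun y => Real.exp ⟪ξ, y⟫) {y | 1 ≤ ‖y‖} ν) :
    Integrable (fun y => Real.cosh ⟪ξ, y⟫ - 1) ν := by
  have hS : MeasurableSet {y : EuclideanSpace ℝ (Fin d) | 1 ≤ ‖y‖} :=
    measurableSet_le measurable_const measurable_norm
  have h1 : Integrable ({y | 1 ≤ ‖y‖}.indicator fun y => Real.exp ⟪ξ, y⟫) ν :=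
    (integrable_indicator_iff hS).2 hξ
  -- Symmetry of `ν` supplies the integrability of `e^{-⟨ξ,y⟩}` for large `y`, the other half of
  -- `cosh`.
  have h2 := h1.comp_neg
  refine ((hν.integrable_min.const_mul (‖ξ‖ ^ 2 / 2 * Real.exp (‖ξ‖ ^ 2 / 2))).add
    (h1.add h2)).mono' (Continuous.aestronglyMeasurable
      ((Real.continuous_cosh.comp (by fun_prop)).sub continuous_const)) (ae_of_all _ fun y => ?_)
  rw [Real.norm_of_nonneg (by linarith [Real.one_le_cosh ⟪ξ, y⟫])]
  by_cases hy : 1 ≤ ‖y‖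
  · have e1 : y ∈ {y : EuclideanSpace ℝ (Fin d) | 1 ≤ ‖y‖} := hy
    have e2 : -y ∈ {y : EuclideanSpace ℝ (Fin d) | 1 ≤ ‖y‖} := by simpa using hy
    simp only [Pi.add_apply, Set.indicator_of_mem e1, Set.indicator_of_mem e2, inner_neg_right]
    rw [Real.cosh_eq]
    have : 0 ≤ ‖ξ‖ ^ 2 / 2 * Real.exp (‖ξ‖ ^ 2 / 2) * min 1 (‖y‖ ^ 2) := by positivity
    linarith [Real.exp_pos ⟪ξ, y⟫, Real.exp_pos (-⟪ξ, y⟫)]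
  · have e1 : y ∉ {y : EuclideanSpace ℝ (Fin d) | 1 ≤ ‖y‖} := hy
    have e2 : -y ∉ {y : EuclideanSpace ℝ (Fin d) | 1 ≤ ‖y‖} := by simpa using hy
    simp only [Pi.add_apply, Set.indicator_of_notMem e1, Set.indicator_of_notMem e2, add_zero]
    have hy1 : ‖y‖ ^ 2 ≤ 1 := pow_le_one₀ (norm_nonneg _) (not_le.1 hy).le
    have h3 : ⟪ξ, y⟫ ^ 2 ≤ ‖ξ‖ ^ 2 * ‖y‖ ^ 2 := by
      rw [← mul_pow, ← sq_abs]
      exact pow_le_pow_left₀ (abs_nonneg _) (abs_real_inner_le_norm ξ y) 2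
    have h4 : ⟪ξ, y⟫ ^ 2 ≤ ‖ξ‖ ^ 2 := h3.trans (mul_le_of_le_one_right (sq_nonneg _) hy1)
    rw [min_eq_right hy1]
    calc Real.cosh ⟪ξ, y⟫ - 1 ≤ ⟪ξ, y⟫ ^ 2 / 2 * Real.exp (⟪ξ, y⟫ ^ 2 / 2) :=
          Real.cosh_sub_one_le _
      _ ≤ ‖ξ‖ ^ 2 * ‖y‖ ^ 2 / 2 * Real.exp (‖ξ‖ ^ 2 / 2) := by gcongr
      _ = _ := by ring

theorem levyExponent_le (hν : IsLevyMeasure ν) (ξ : EuclideanSpace ℝ (Fin d)) :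
    levyExponent ν ξ ≤ (2 + ‖ξ‖ ^ 2) * ∫ y, min 1 (‖y‖ ^ 2) ∂ν := by
  rw [levyExponent, ← integral_const_mul]
  exact integral_mono (hν.integrable_one_sub_cos ξ) (hν.integrable_min.const_mul _)
    (one_sub_cos_inner_le ξ)

theorem levyExponent_le_two_mul_add (hν : IsLevyMeasure ν) (a b : EuclideanSpace ℝ (Fin d)) :
    levyExponent ν a ≤ 2 * levyExponent ν (a + b) + 2 * levyExponent ν b := by
  simp only [levyExponent]
  rw [← integral_const_mul, ← integral_const_mul, ← integral_add
    ((hν.integrable_one_sub_cos _).const_mul 2) ((hν.integrable_one_sub_cos _).const_mul 2)]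
  refine integral_mono (hν.integrable_one_sub_cos a)
    (((hν.integrable_one_sub_cos _).const_mul 2).add
      ((hν.integrable_one_sub_cos _).const_mul 2)) fun y => ?_
  simp only [inner_add_left]
  exact Real.one_sub_cos_le_two_mul_add _ _

end IsLevyMeasure

/-! ### The characteristic exponent at complex frequencies. -/

/-- The holomorphic extension `w ↦ Ψ(z + w ξ)` of the characteristic exponent. -/
noncomputable def levyExponentC (ν : Measure (EuclideanSpace ℝ (Fin d)))
    (ξ z : EuclideanSpace ℝ (Fin d)) (w : ℂ) : ℂ :=
  ∫ y, (1 - Complex.cos ((⟪z, y⟫ : ℝ) + w * (⟪ξ, y⟫ : ℝ))) ∂ν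

theorem levyExponentC_zero (ξ z : EuclideanSpace ℝ (Fin d)) :
    levyExponentC ν ξ z 0 = levyExponent ν z := by
  rw [levyExponentC, levyExponent]
  refine Eq.trans ?_ integral_ofReal
  refine integral_congr_ae (ae_of_all _ fun y => ?_)
  simp

theorem levyExponentC_add_ofReal (ξ z : EuclideanSpace ℝ (Fin d)) (w : ℂ) (h : ℝ) :
    levyExponentC ν ξ z (w + h) = levyExponentC ν ξ (z + h • ξ) w := by
  rw [levyExponentC, levyExponentC]
  refine integral_congr_ae (ae_of_all _ fun y => ?_)
  simp only [inner_add_left, real_inner_smul_left]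
  push_cast
  ring_nf

/-- The modulus splits as `(1 - cos Re) + (cosh Im - 1)`. The resulting majorant is uniform for
bounded `z` and `Re w`, and serves both holomorphy in `w` and continuity in `z`. -/
theorem norm_one_sub_cos_inner_le (ξ z y : EuclideanSpace ℝ (Fin d)) {w : ℂ} (hw : |w.im| ≤ 1)
    {K : ℝ} (hK : ‖z‖ + |w.re| * ‖ξ‖ ≤ K) :
    ‖1 - Complex.cos ((⟪z, y⟫ : ℝ) + w * (⟪ξ, y⟫ : ℝ))‖
      ≤ (2 + K ^ 2) * min 1 (‖y‖ ^ 2) + (Real.cosh ⟪ξ, y⟫ - 1) := by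
  rw [Complex.norm_one_sub_cos]
  have hre : ((⟪z, y⟫ : ℝ) + w * (⟪ξ, y⟫ : ℝ) : ℂ).re = ⟪z + w.re • ξ, y⟫ := by
    simp [inner_add_left, real_inner_smul_left]
  have him : ((⟪z, y⟫ : ℝ) + w * (⟪ξ, y⟫ : ℝ) : ℂ).im = w.im * ⟪ξ, y⟫ := by simp
  rw [hre, him]
  have h1 := one_sub_cos_inner_le (z + w.re • ξ) y
  have h2 : Real.cosh (w.im * ⟪ξ, y⟫) ≤ Real.cosh ⟪ξ, y⟫ := by
    rw [Real.cosh_le_cosh, abs_mul]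
    exact mul_le_of_le_one_left (abs_nonneg _) hw
  have h3 : ‖z + w.re • ξ‖ ≤ K :=
    (norm_add_le _ _).trans (by rwa [norm_smul, Real.norm_eq_abs])
  have h4 : (2 + ‖z + w.re • ξ‖ ^ 2) * min 1 (‖y‖ ^ 2) ≤ (2 + K ^ 2) * min 1 (‖y‖ ^ 2) := by
    gcongr
  linarith

namespace IsLevyMeasure

variable {ξ : EuclideanSpace ℝ (Fin d)}

theorem integrable_one_sub_cosC (hν : IsLevyMeasure ν)
    (hξ : Integrable (fun y => Real.cosh ⟪ξ, y⟫ - 1) ν) (z : EuclideanSpace ℝ (Fin d)) {w : ℂ}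
    (hw : |w.im| ≤ 1) :
    Integrable (fun y => 1 - Complex.cos ((⟪z, y⟫ : ℝ) + w * (⟪ξ, y⟫ : ℝ))) ν :=
  ((hν.integrable_min.const_mul _).add hξ).mono'
    (Continuous.aestronglyMeasurable (by fun_prop))
    (ae_of_all _ fun y => norm_one_sub_cos_inner_le ξ z y hw le_rfl)

theorem differentiableOn_levyExponentC (hν : IsLevyMeasure ν)
    (hξ : Integrable (fun y => Real.cosh ⟪ξ, y⟫ - 1) ν) (z : EuclideanSpace ℝ (Fin d)) :
    DifferentiableOn ℂ (levyExponentC ν ξ z) (Complex.im ⁻¹' Set.Ioo (-1) 1) := by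
  have hU : IsOpen (Complex.im ⁻¹' Set.Ioo (-1) 1) := isOpen_Ioo.preimage Complex.continuous_im
  refine differentiableOn_integral_of_locally_dominated hU
    (fun w hw => Continuous.aestronglyMeasurable (by fun_prop)) (fun y => by fun_prop)
    fun w hw => ⟨_, (hν.integrable_min.const_mul
      (2 + (‖z‖ + (|w.re| + 1) * ‖ξ‖) ^ 2)).add hξ, ?_⟩
  filter_upwards [hU.mem_nhds hw, Metric.ball_mem_nhds w one_pos] with v hv hvw y
  refine norm_one_sub_cos_inner_le ξ z y (abs_le.2 ⟨hv.1.le, hv.2.le⟩) ?_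
  gcongr
  have h1 : |(v - w).re| ≤ ‖v - w‖ := Complex.abs_re_le_norm _
  have h2 : ‖v - w‖ < 1 := by rwa [Metric.mem_ball, dist_eq_norm] at hvw
  have h3 := abs_add_le w.re (v - w).re
  rw [Complex.sub_re] at h1 h3
  rw [add_sub_cancel] at h3
  linarith

theorem continuous_levyExponentC (hν : IsLevyMeasure ν)
    (hξ : Integrable (fun y => Real.cosh ⟪ξ, y⟫ - 1) ν) {w : ℂ} (hw : |w.im| ≤ 1) :
    Continuous fun z => levyExponentC ν ξ z w := by
  refine continuous_iff_continuousAt.2 fun z => ?_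
  refine continuousAt_of_dominated (bound := fun y =>
    (2 + (‖z‖ + 1 + |w.re| * ‖ξ‖) ^ 2) * min 1 (‖y‖ ^ 2) + (Real.cosh ⟪ξ, y⟫ - 1))
    (Eventually.of_forall fun v => Continuous.aestronglyMeasurable (by fun_prop)) ?_
    ((hν.integrable_min.const_mul _).add hξ)
    (ae_of_all _ fun y => Continuous.continuousAt (by fun_prop))
  filter_upwards [Metric.ball_mem_nhds z one_pos] with v hv
  refine ae_of_all _ fun y => norm_one_sub_cos_inner_le ξ v y hw ?_
  gcongr
  have h2 : ‖v - z‖ < 1 := by rwa [Metric.mem_ball, dist_eq_norm] at hv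
  have h3 := norm_add_le z (v - z)
  rw [add_sub_cancel] at h3
  linarith

theorem le_re_levyExponentC (hν : IsLevyMeasure ν)
    (hξ : Integrable (fun y => Real.cosh ⟪ξ, y⟫ - 1) ν) (z : EuclideanSpace ℝ (Fin d)) {w : ℂ}
    (hw : |w.im| ≤ 1) :
    levyExponent ν (z + w.re • ξ) - levyOmega ν ξ ≤ (levyExponentC ν ξ z w).re := by
  have hint := hν.integrable_one_sub_cosC hξ z hw
  have e : (levyExponentC ν ξ z w).re
      = ∫ y, (1 - Complex.cos ((⟪z, y⟫ : ℝ) + w * (⟪ξ, y⟫ : ℝ))).re ∂ν :=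
    (integral_re hint).symm
  rw [e, levyExponent, levyOmega, ← integral_sub (hν.integrable_one_sub_cos _) hξ]
  refine integral_mono ((hν.integrable_one_sub_cos _).sub hξ) hint.re fun y => ?_
  have h1 := Complex.re_one_sub_cos_ge ((⟪z, y⟫ : ℝ) + w * (⟪ξ, y⟫ : ℝ))
  have hre : ((⟪z, y⟫ : ℝ) + w * (⟪ξ, y⟫ : ℝ) : ℂ).re = ⟪z + w.re • ξ, y⟫ := by
    simp [inner_add_left, real_inner_smul_left]
  have him : ((⟪z, y⟫ : ℝ) + w * (⟪ξ, y⟫ : ℝ) : ℂ).im = w.im * ⟪ξ, y⟫ := by simp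
  rw [hre, him] at h1
  have h2 : Real.cosh (w.im * ⟪ξ, y⟫) ≤ Real.cosh ⟪ξ, y⟫ := by
    rw [Real.cosh_le_cosh, abs_mul]
    exact mul_le_of_le_one_left (abs_nonneg _) hw
  change _ ≤ (1 - Complex.cos _).re
  linarith

end IsLevyMeasure

/-! ### The contour shift. -/

variable {ξ : EuclideanSpace ℝ (Fin d)}

/-- The integrand of the Fourier inversion formula at `x`, evaluated at the complex frequency
`z + w ξ`. -/
noncomputable def inversionIntegrand (ν : Measure (EuclideanSpace ℝ (Fin d)))
    (ξ x : EuclideanSpace ℝ (Fin d)) (t : ℝ) (w : ℂ) (z : EuclideanSpace ℝ (Fin d)) : ℂ :=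
  Complex.exp (-((⟪z, x⟫ : ℝ) + w * (⟪ξ, x⟫ : ℝ)) * Complex.I)
    * Complex.exp (-(t * levyExponentC ν ξ z w))

theorem inversionIntegrand_add_ofReal (x : EuclideanSpace ℝ (Fin d)) (t : ℝ) (w : ℂ) (h : ℝ)
    (z : EuclideanSpace ℝ (Fin d)) :
    inversionIntegrand ν ξ x t (w + h) z = inversionIntegrand ν ξ x t w (z + h • ξ) := by
  rw [inversionIntegrand, inversionIntegrand, levyExponentC_add_ofReal, inner_add_left,
    real_inner_smul_left]
  push_cast
  ring_nf

namespace IsLevyMeasure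

theorem norm_inversionIntegrand_le (hν : IsLevyMeasure ν)
    (hξ : Integrable (fun y => Real.cosh ⟪ξ, y⟫ - 1) ν) (x z : EuclideanSpace ℝ (Fin d))
    {t : ℝ} (ht : 0 ≤ t) {w : ℂ} (hw : |w.im| ≤ 1) :
    ‖inversionIntegrand ν ξ x t w z‖ ≤ Real.exp (w.im * ⟪ξ, x⟫ + t * levyOmega ν ξ)
      * Real.exp (-(t * levyExponent ν (z + w.re • ξ))) := by
  rw [inversionIntegrand, norm_mul, Complex.norm_exp, Complex.norm_exp, ← Real.exp_add,
    ← Real.exp_add, Real.exp_le_exp]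
  have h := mul_le_mul_of_nonneg_left (hν.le_re_levyExponentC hξ z hw) ht
  simp
  linarith

theorem continuous_inversionIntegrand (hν : IsLevyMeasure ν)
    (hξ : Integrable (fun y => Real.cosh ⟪ξ, y⟫ - 1) ν) (x : EuclideanSpace ℝ (Fin d))
    (t : ℝ) {w : ℂ} (hw : |w.im| ≤ 1) : Continuous (inversionIntegrand ν ξ x t w) := by
  have := hν.continuous_levyExponentC hξ hw
  unfold inversionIntegrand
  fun_prop

/-- Comparing `Ψ(z + Re(v) ξ)` with `Ψ(z)` costs a factor 2, whence the majorant `e^{-(t/2)Ψ(z)}`.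
-/
theorem differentiableOn_integral_inversionIntegrand (hν : IsLevyMeasure ν)
    (hξ : Integrable (fun y => Real.cosh ⟪ξ, y⟫ - 1) ν) (x : EuclideanSpace ℝ (Fin d))
    {t : ℝ} (ht : 0 < t)
    (hΨ : Integrable fun z : EuclideanSpace ℝ (Fin d) =>
      Real.exp (-(t / 2 * levyExponent ν z))) :
    DifferentiableOn ℂ (fun w => ∫ z, inversionIntegrand ν ξ x t w z)
      (Complex.im ⁻¹' Set.Ioo (-1) 1) := by
  have hU : IsOpen (Complex.im ⁻¹' Set.Ioo (-1) 1) := isOpen_Ioo.preimage Complex.continuous_im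
  refine differentiableOn_integral_of_locally_dominated hU (fun w hw =>
    (hν.continuous_inversionIntegrand hξ x t (abs_le.2 ⟨hw.1.le, hw.2.le⟩)).aestronglyMeasurable)
    (fun z => ?_) fun w hw => ?_
  · have := hν.differentiableOn_levyExponentC hξ z
    unfold inversionIntegrand
    fun_prop
  -- `M` bounds `Ψ(Re(v) ξ)` for all `v` in the unit ball around `w`.
  set M : ℝ := (2 + ((|w.re| + 1) * ‖ξ‖) ^ 2) * ∫ y, min 1 (‖y‖ ^ 2) ∂ν with hM
  refine ⟨_, hΨ.const_mul (Real.exp (|⟪ξ, x⟫| + t * levyOmega ν ξ + t * M)), ?_⟩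
  filter_upwards [hU.mem_nhds hw, Metric.ball_mem_nhds w one_pos] with v hv hvw z
  have hv1 : |v.im| ≤ 1 := abs_le.2 ⟨hv.1.le, hv.2.le⟩
  refine (hν.norm_inversionIntegrand_le hξ x z ht.le hv1).trans ?_
  rw [← Real.exp_add, ← Real.exp_add, Real.exp_le_exp]
  have hvre : |v.re| ≤ |w.re| + 1 := by
    have h1 : |(v - w).re| ≤ ‖v - w‖ := Complex.abs_re_le_norm _
    have h2 : ‖v - w‖ < 1 := by rwa [Metric.mem_ball, dist_eq_norm] at hvw
    have h3 := abs_add_le w.re (v - w).re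
    rw [Complex.sub_re] at h1 h3
    rw [add_sub_cancel] at h3
    linarith
  have h1 : v.im * ⟪ξ, x⟫ ≤ |⟪ξ, x⟫| := by
    refine (le_abs_self _).trans ?_
    rw [abs_mul]
    exact mul_le_of_le_one_left (abs_nonneg _) hv1
  have h2 : levyExponent ν (v.re • ξ) ≤ M := by
    refine (hν.levyExponent_le _).trans ?_
    have : 0 ≤ ∫ y, min 1 (‖y‖ ^ 2) ∂ν := integral_nonneg fun y => by positivity
    rw [norm_smul, Real.norm_eq_abs, hM]
    gcongr
  have h3 := hν.levyExponent_le_two_mul_add z (v.re • ξ)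
  have h4 : t * (levyExponent ν z / 2 - M) ≤ t * levyExponent ν (z + v.re • ξ) :=
    mul_le_mul_of_nonneg_left (by linarith) ht.le
  linarith

/-- A real shift of `w` is a translation of `z`, which leaves the integral unchanged. The complex
derivative, computed along the real direction, therefore vanishes on the connected strip. -/
theorem integral_inversionIntegrand_eq (hν : IsLevyMeasure ν)
    (hξ : Integrable (fun y => Real.cosh ⟪ξ, y⟫ - 1) ν) (x : EuclideanSpace ℝ (Fin d))
    {t : ℝ} (ht : 0 < t)
    (hΨ : Integrable fun z : EuclideanSpace ℝ (Fin d) =>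
      Real.exp (-(t / 2 * levyExponent ν z))) {w : ℂ} (hw : w.im ∈ Set.Ioo (-1 : ℝ) 1) :
    ∫ z, inversionIntegrand ν ξ x t w z = ∫ z, inversionIntegrand ν ξ x t 0 z := by
  have hU : IsOpen (Complex.im ⁻¹' Set.Ioo (-1) 1) := isOpen_Ioo.preimage Complex.continuous_im
  have hconv : Convex ℝ (Complex.im ⁻¹' Set.Ioo (-1) 1) :=
    (convex_Ioo (-1 : ℝ) 1).linear_preimage Complex.imLm
  have hdiff := hν.differentiableOn_integral_inversionIntegrand hξ x ht hΨ
  refine hU.is_const_of_fderiv_eq_zero hconv.isPreconnected hdiff (fun v hv => ?_) hw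
    (by simp)
  have hd := (hdiff.differentiableAt (hU.mem_nhds hv)).hasDerivAt
  have hshift : ∀ h : ℝ, ∫ z, inversionIntegrand ν ξ x t (v + h) z
      = ∫ z, inversionIntegrand ν ξ x t v z := fun h => by
    simp only [inversionIntegrand_add_ofReal]
    exact integral_add_right_eq_self (inversionIntegrand ν ξ x t v) (h • ξ)
  have h0 : HasDerivAt (fun h : ℝ => ∫ z, inversionIntegrand ν ξ x t (v + h) z)
      (deriv (fun w => ∫ z, inversionIntegrand ν ξ x t w z) v) 0 := by
    have h00 : HasDerivAt (fun u : ℂ => ∫ z, inversionIntegrand ν ξ x t (v + u) z)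
        (deriv (fun w => ∫ z, inversionIntegrand ν ξ x t w z) v) ((0 : ℝ) : ℂ) :=
      HasDerivAt.comp_const_add (f := fun w => ∫ z, inversionIntegrand ν ξ x t w z) v _
        (by simpa using hd)
    exact h00.comp_ofReal
  simp only [hshift] at h0
  have h1 := h0.unique (hasDerivAt_const (0 : ℝ) _)
  ext
  simpa using h1

/-- The contour shift `z ↦ z - i s ξ` in the Fourier inversion formula. -/
theorem norm_integral_inversionIntegrand_zero_le (hν : IsLevyMeasure ν)
    (hξ : Integrable (fun y => Real.cosh ⟪ξ, y⟫ - 1) ν) (x : EuclideanSpace ℝ (Fin d))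
    {t : ℝ} (ht : 0 < t)
    (hΨ : ∀ t : ℝ, 0 < t → Integrable fun z : EuclideanSpace ℝ (Fin d) =>
      Real.exp (-(t * levyExponent ν z))) :
    ‖∫ z, inversionIntegrand ν ξ x t 0 z‖ ≤ Real.exp (-⟪ξ, x⟫ + t * levyOmega ν ξ)
      * ∫ z, Real.exp (-(t * levyExponent ν z)) := by
  -- Holomorphy holds only on the open strip, so the shift to `w = -is` is made for `s < 1` and the
  -- bound passes to the limit `s → 1`.
  have hs : ∀ s ∈ Set.Ioo (0 : ℝ) 1, ‖∫ z, inversionIntegrand ν ξ x t 0 z‖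
      ≤ Real.exp (-s * ⟪ξ, x⟫ + t * levyOmega ν ξ)
        * ∫ z, Real.exp (-(t * levyExponent ν z)) := by
    intro s hs
    have him : ((-s : ℝ) * Complex.I).im = -s := by simp
    have hre : ((-s : ℝ) * Complex.I).re = 0 := by simp
    rw [← hν.integral_inversionIntegrand_eq hξ x ht (hΨ _ (half_pos ht))
      (w := (-s : ℝ) * Complex.I) (by rw [him]; constructor <;> linarith [hs.1, hs.2]),
      ← integral_const_mul]
    refine norm_integral_le_of_norm_le ((hΨ t ht).const_mul _) (ae_of_all _ fun z => ?_)
    have h := hν.norm_inversionIntegrand_le hξ x z ht.le (w := (-s : ℝ) * Complex.I)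
      (by rw [him, abs_neg, abs_of_pos hs.1]; exact hs.2.le)
    rwa [him, hre, zero_smul, add_zero] at h
  have hlim : Tendsto (fun s : ℝ => Real.exp (-s * ⟪ξ, x⟫ + t * levyOmega ν ξ)
      * ∫ z, Real.exp (-(t * levyExponent ν z))) (𝓝[<] 1)
      (𝓝 (Real.exp (-1 * ⟪ξ, x⟫ + t * levyOmega ν ξ)
        * ∫ z, Real.exp (-(t * levyExponent ν z)))) :=
    (Continuous.tendsto (by fun_prop) 1).mono_left nhdsWithin_le_nhds
  rw [neg_one_mul] at hlim
  exact ge_of_tendsto hlim (mem_of_superset (Ioo_mem_nhdsLT one_pos) hs)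

end IsLevyMeasure

/-! ### Uniqueness of the density and conclusion. -/

theorem IsContinuousDensity.eq {m : Measure (EuclideanSpace ℝ (Fin d))}
    {p q : EuclideanSpace ℝ (Fin d) → ℝ} (hp : IsContinuousDensity m p)
    (hq : IsContinuousDensity m q) : p = q := by
  have h := hp.eq_withDensity.symm.trans hq.eq_withDensity
  rw [withDensity_eq_iff_of_sigmaFinite
    (hp.continuous.measurable.ennreal_ofReal.aemeasurable)
    (hq.continuous.measurable.ennreal_ofReal.aemeasurable)] at h
  refine (Continuous.ae_eq_iff_eq volume hp.continuous hq.continuous).1 ?_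
  filter_upwards [h] with x hx
  exact (ENNReal.ofReal_eq_ofReal_iff (hp.nonneg x) (hq.nonneg x)).1 hx

theorem isContinuousDensity_charFunInv {m : Measure (EuclideanSpace ℝ (Fin d))}
    [IsFiniteMeasure m] (hm : Integrable (charFun m)) :
    IsContinuousDensity m fun x => (charFunInv m x).re where
  continuous := Complex.continuous_re.comp (continuous_charFunInv hm)
  nonneg := charFunInv_re_nonneg hm
  eq_withDensity := eq_withDensity_charFunInv hm

theorem charFunInv_eq_integral_inversionIntegrand {m : Measure (EuclideanSpace ℝ (Fin d))}
    {t : ℝ} (hm : ∀ z, charFun m z = Complex.exp ((-(t * levyExponent ν z) : ℝ) : ℂ))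
    (ξ x : EuclideanSpace ℝ (Fin d)) :
    charFunInv m x = (((2 * Real.pi) ^ d)⁻¹ : ℝ) • ∫ z, inversionIntegrand ν ξ x t 0 z := by
  rw [charFunInv_apply, finrank_euclideanSpace_fin]
  congr 1
  refine integral_congr_ae (ae_of_all _ fun z => ?_)
  simp only [inversionIntegrand, hm, levyExponentC_zero, zero_mul, add_zero]
  push_cast
  rfl

theorem mainTheorem4 {d : ℕ}
    (ν : Measure (EuclideanSpace ℝ (Fin d))) (hν : IsLevyMeasure ν)
    (hν_symm : ν.IsNegInvariant)
    (μ : ℝ≥0 → Measure (EuclideanSpace ℝ (Fin d))) (hμ : IsConvolutionSemigroup μ)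
    (hμ_charFun : ∀ (t : ℝ≥0) (ξ : EuclideanSpace ℝ (Fin d)),
      charFun (μ t) ξ = Complex.exp ((-((t : ℝ) * levyExponent ν ξ) : ℝ) : ℂ))
    (hΨ : ∀ t : ℝ, 0 < t →
      Integrable (fun z : EuclideanSpace ℝ (Fin d) => Real.exp (-(t * levyExponent ν z))) volume)
    (ξ₀ : EuclideanSpace ℝ (Fin d))
    (hξ₀ : IntegrableOn (fun y : EuclideanSpace ℝ (Fin d) => Real.exp (inner ℝ ξ₀ y))
      {y | 1 ≤ ‖y‖} ν) :
    Integrable (fun y : EuclideanSpace ℝ (Fin d) => Real.cosh (inner ℝ ξ₀ y) - 1) ν ∧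
    ∀ t : ℝ≥0, 0 < t →
      (∃! p, IsContinuousDensity (μ t) p) ∧
      ∀ p, IsContinuousDensity (μ t) p →
        ∀ x, p x ≤ p 0 * Real.exp (-(inner ℝ ξ₀ x) + (t : ℝ) * levyOmega ν ξ₀) := by
  have hω := hν.integrable_cosh_sub_one hν_symm hξ₀
  refine ⟨hω, fun t ht => ?_⟩
  have ht' : (0 : ℝ) < t := ht
  have := hμ.isProbabilityMeasure t
  have hint : Integrable (charFun (μ t)) :=
    (hΨ t ht').ofReal.congr (ae_of_all _ fun z => by
      rw [hμ_charFun]; exact Complex.ofReal_exp _)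
  have hdens := isContinuousDensity_charFunInv hint
  refine ⟨⟨_, hdens, fun q hq => hq.eq hdens⟩, fun p hp x => ?_⟩
  rw [hp.eq hdens]
  have hc : 0 ≤ ((2 * Real.pi) ^ d)⁻¹ := by positivity
  -- At `x = 0` the inversion integrand is real and positive, so `p_t(0)` is exactly the constant
  -- left by the contour shift.
  have hzero : (charFunInv (μ t) 0).re
      = ((2 * Real.pi) ^ d)⁻¹ * ∫ z, Real.exp (-(t * levyExponent ν z)) := by
    have h : ∀ z, inversionIntegrand ν ξ₀ 0 t 0 z
        = ((Real.exp (-(t * levyExponent ν z)) : ℝ) : ℂ) := fun z => by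
      simp [inversionIntegrand, levyExponentC_zero]
    rw [charFunInv_eq_integral_inversionIntegrand (hμ_charFun t) ξ₀ 0, Complex.smul_re,
      smul_eq_mul]
    simp only [h]
    congr 1
    exact congrArg Complex.re integral_ofReal
  calc (charFunInv (μ t) x).re ≤ ‖charFunInv (μ t) x‖ := Complex.re_le_norm _
    _ = ((2 * Real.pi) ^ d)⁻¹ * ‖∫ z, inversionIntegrand ν ξ₀ x t 0 z‖ := by
      rw [charFunInv_eq_integral_inversionIntegrand (hμ_charFun t) ξ₀ x, norm_smul,
        Real.norm_of_nonneg hc]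
    _ ≤ ((2 * Real.pi) ^ d)⁻¹ * (Real.exp (-⟪ξ₀, x⟫ + t * levyOmega ν ξ₀)
        * ∫ z, Real.exp (-(t * levyExponent ν z))) :=
      mul_le_mul_of_nonneg_left
        (hν.norm_integral_inversionIntegrand_zero_le hω x ht' hΨ) hc
    _ = (charFunInv (μ t) 0).re * Real.exp (-⟪ξ₀, x⟫ + t * levyOmega ν ξ₀) := by
      rw [hzero]; ring
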